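/- Let $\Lambda_{\mathbb Q}$ be the ring of symmetric functions over $\mathbb Q$ in variables $x=(x_1,x_2,\dots)$, with elementary, complete homogeneous, power sum and monomial symmetric functions $e_k,h_k,p_k,m_\lambda$, with the scalar product determined by $\langle m_\lambda,h_\mu\rangle=\delta_{\lambda\mu}$, and with the algebra involution $\omega$ determined by $\omega(e_k)=h_k$ for $k\ge 1$. For $f\in\Lambda_{\mathbb Q}$, let $f(x/y)=\omega_y f(x,y)$ be the superfication of $f$, where $f(x,y)$ is $f$ in the two sets of variables $x$ and $y=(y_1,y_2,\dots)$ together and $\omega_y$ is $\omega$ acting on the $y$ variables only. The shiftification $f(x/x)$ of $f$ is obtained from $f(x/y)$ by setting $y_i=x_i$ for all $i$. A parking function of length $n$ is a sequence $(a_1,\dots,a_n)$ of positive integers whose weakly increasing rearrangement $b_1\le\cdots\le b_n$ satisfies $b_i\le i$ for all $i$. The symmetric group $\mathfrak S_n$ acts on the set of parking functions of length $n$ by permuting coordinates. Let $\mathrm{pf}_n=\frac1{n!}\sum_{w\in\mathfrak S_n}\chi_n(w)\,p_{\rho(w)}$ be the Frobenius characteristic of the character $\chi_n$ of this action (where $\rho(w)$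 is the cycle type of $w$ and $p_\lambda=p_{\lambda_1}p_{\lambda_2}\cdots$), and let $\mathrm{sh}_n=\mathrm{pf}_n(x/x)$ be its shiftification. Then for every integer $n\ge 0$ the dimension $\langle \mathrm{sh}_n,p_1^n\rangle$ of $\mathrm{sh}_n$ satisfies $$\langle \mathrm{sh}_n,p_1^n\rangle = 2^n(n+1)^{n-1}.$$ -/

import Mathlib

namespace SymmFn

open MvPowerSeries

noncomputable section

/-! ### The ring of symmetric functions -/

/-- Invariance under permutations of the variables. -/
def IsSymm (f : MvPowerSeries ℕ ℚ) : Prop := ∀ σ : Equiv.Perm ℕ, rename σ f = f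

/-- All monomials occurring in `f` have degree at most `d`. -/
def DegLE {ι : Type} (d : ℕ) (f : MvPowerSeries ι ℚ) : Prop :=
  ∀ m : ι →₀ ℕ, d < m.degree → coeff m f = 0

theorem isSymm_iff (f : MvPowerSeries ℕ ℚ) :
    IsSymm f ↔ ∀ (σ : Equiv.Perm ℕ) (m : ℕ →₀ ℕ), coeff (m.mapDomain σ) f = coeff m f := by
  have key (σ : Equiv.Perm ℕ) (m : ℕ →₀ ℕ) : coeff (m.mapDomain σ) (rename σ f) = coeff m f := by
    have := coeff_embDomain_rename (R := ℚ) σ.toEmbedding f m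
    rw [Finsupp.embDomain_eq_mapDomain] at this
    exact this
  constructor
  · intro h σ m
    rw [← key σ m, h σ]
  · intro h σ
    ext m
    have hm : m = (m.mapDomain σ.symm).mapDomain σ := by
      rw [← Finsupp.mapDomain_comp]; simp
    have h2 := h σ.symm m
    rw [← key σ (m.mapDomain σ.symm), ← hm] at h2
    exact h2

theorem DegLE.mul {ι : Type} {c d : ℕ} {f g : MvPowerSeries ι ℚ} (hf : DegLE c f)
    (hg : DegLE d g) : DegLE (c + d) (f * g) := by
  classical
  intro m hm
  rw [coeff_mul]
  refine Finset.sum_eq_zero fun p hp => ?_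
  rw [Finset.HasAntidiagonal.mem_antidiagonal] at hp
  rw [← hp, map_add] at hm
  rcases lt_or_ge c p.1.degree with h | h
  · rw [hf _ h, zero_mul]
  · rw [hg _ (by omega), mul_zero]

/-- The `ℚ`-algebra `Λ_ℚ` of symmetric functions in `x_0, x_1, x_2, …`: formal power series with
rational coefficients, of bounded degree, and invariant under permutations of the variables. -/
def Lam : Subalgebra ℚ (MvPowerSeries ℕ ℚ) where
  carrier := {f | IsSymm f ∧ ∃ d, DegLE d f}
  mul_mem' := by
    rintro f g ⟨hf, c, hc⟩ ⟨hg, d, hd⟩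
    exact ⟨fun σ => by rw [map_mul, hf, hg], c + d, hc.mul hd⟩
  add_mem' := by
    rintro f g ⟨hf, c, hc⟩ ⟨hg, d, hd⟩
    refine ⟨fun σ => by rw [map_add, hf, hg], c + d, fun m hm => ?_⟩
    rw [map_add, hc m (by omega), hd m (by omega), add_zero]
  algebraMap_mem' := by
    classical
    intro r
    refine ⟨fun σ => by rw [AlgHom.commutes], 0, fun m hm => ?_⟩
    rw [MvPowerSeries.algebraMap_apply, coeff_C, if_neg]
    rintro rfl
    simp at hm

open Classical in
/-- The elementary symmetric series `e_k`: the sum of all squarefree monomials of degree `k`. -/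
def eSeries (k : ℕ) : MvPowerSeries ℕ ℚ :=
  fun m => if (∀ i, m i ≤ 1) ∧ m.degree = k then 1 else 0

open Classical in
/-- The complete homogeneous symmetric series `h_k`: the sum of all monomials of degree `k`. -/
def hSeries (k : ℕ) : MvPowerSeries ℕ ℚ :=
  fun m => if m.degree = k then 1 else 0

open Classical in
/-- The power sum series `p_k = ∑ x_i ^ k` (used for `k ≥ 1`). -/
def pSeries (k : ℕ) : MvPowerSeries ℕ ℚ :=
  fun m => if ∃ i, m = Finsupp.single i k then 1 else 0

open Classical in
theorem coeff_eSeries (k : ℕ) (m : ℕ →₀ ℕ) :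
    coeff m (eSeries k) = if (∀ i, m i ≤ 1) ∧ m.degree = k then 1 else 0 := rfl

theorem coeff_hSeries (k : ℕ) (m : ℕ →₀ ℕ) :
    coeff m (hSeries k) = if m.degree = k then 1 else 0 := by
  classical
  simp only [hSeries, coeff_apply]
  

open Classical in
theorem coeff_pSeries (k : ℕ) (m : ℕ →₀ ℕ) :
    coeff m (pSeries k) = if ∃ i, m = Finsupp.single i k then 1 else 0 := rfl

theorem eSeries_mem (k : ℕ) : eSeries k ∈ Lam := by
  classical
  refine ⟨(isSymm_iff _).2 fun σ m => ?_, k, fun m hm => ?_⟩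
  · rw [coeff_eSeries, coeff_eSeries, Finsupp.degree_mapDomain]
    refine if_congr (and_congr_left fun _ => ?_) rfl rfl
    rw [← Finsupp.equivMapDomain_eq_mapDomain]
    simp only [Finsupp.equivMapDomain_apply]
    exact σ.symm.forall_congr_left (p := fun i => m (σ.symm i) ≤ 1) |>.trans (by simp)
  · rw [coeff_eSeries, if_neg]
    omega

theorem hSeries_mem (k : ℕ) : hSeries k ∈ Lam := by
  classical
  refine ⟨(isSymm_iff _).2 fun σ m => ?_, k, fun m hm => ?_⟩
  · rw [coeff_hSeries, coeff_hSeries, Finsupp.degree_mapDomain]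
  · rw [coeff_hSeries, if_neg]
    omega

theorem pSeries_mem (k : ℕ) : pSeries k ∈ Lam := by
  classical
  refine ⟨(isSymm_iff _).2 fun σ m => ?_, k, fun m hm => ?_⟩
  · rw [coeff_pSeries, coeff_pSeries]
    refine if_congr ⟨?_, ?_⟩ rfl rfl
    · rintro ⟨i, hi⟩
      refine ⟨σ.symm i, Finsupp.mapDomain_injective σ.injective ?_⟩
      rw [hi, Finsupp.mapDomain_single, Equiv.apply_symm_apply]
    · rintro ⟨i, rfl⟩
      exact ⟨σ i, Finsupp.mapDomain_single⟩
  · rw [coeff_pSeries, if_neg]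
    rintro ⟨i, rfl⟩
    rw [Finsupp.degree_single] at hm
    omega

/-- The elementary symmetric function `e_k`. -/
def e (k : ℕ) : Lam := ⟨eSeries k, eSeries_mem k⟩

/-- The complete homogeneous symmetric function `h_k`. -/
def h (k : ℕ) : Lam := ⟨hSeries k, hSeries_mem k⟩

/-- The power sum symmetric function `p_k`, `k ≥ 1`. -/
def p (k : ℕ) : Lam := ⟨pSeries k, pSeries_mem k⟩

/-! ### `Λ_ℚ` is the polynomial ring in `e_1, e_2, …` and in `h_1, h_2, …` -/

/-- Substituting `e_{i+1}` for the `i`-th variable. -/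
def evalE : MvPolynomial ℕ ℚ →ₐ[ℚ] Lam := MvPolynomial.aeval fun i => e (i + 1)

/-- Substituting `h_{i+1}` for the `i`-th variable. -/
def evalH : MvPolynomial ℕ ℚ →ₐ[ℚ] Lam := MvPolynomial.aeval fun i => h (i + 1)

/-- The degree `∑ i, m i * (i + 1)` of a monomial in `e_1, e_2, …` or in `h_1, h_2, …`. -/
def wt : (ℕ →₀ ℕ) →+ ℕ := Finsupp.weight fun i => i + 1

/-- Homogeneity of degree `d`. -/
def HomDeg (d : ℕ) (f : MvPowerSeries ℕ ℚ) : Prop :=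
  ∀ n : ℕ →₀ ℕ, n.degree ≠ d → coeff n f = 0

theorem HomDeg.mul {c d : ℕ} {f g : MvPowerSeries ℕ ℚ} (hf : HomDeg c f) (hg : HomDeg d g) :
    HomDeg (c + d) (f * g) := by
  classical
  intro m hm
  rw [coeff_mul]
  refine Finset.sum_eq_zero fun p hp => ?_
  rw [Finset.HasAntidiagonal.mem_antidiagonal] at hp
  rw [← hp, map_add] at hm
  by_cases h : p.1.degree = c
  · rw [hg _ (by omega), mul_zero]
  · rw [hf _ h, zero_mul]

theorem HomDeg.one : HomDeg 0 1 := by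
  classical
  intro n hn
  rw [coeff_one, if_neg]
  rintro rfl
  exact hn (map_zero _)

theorem homDeg_prod {u : ℕ → MvPowerSeries ℕ ℚ} (hu : ∀ i, HomDeg (i + 1) (u i))
    (m : ℕ →₀ ℕ) : HomDeg (wt m) (m.prod fun i k => u i ^ k) := by
  induction m using Finsupp.induction_linear with
  | zero => simpa using HomDeg.one
  | add f g hf hg =>
    rw [Finsupp.prod_add_index' (fun _ => pow_zero _) (fun _ _ _ => pow_add _ _ _), map_add]
    exact hf.mul hg
  | single i k =>
    rw [Finsupp.prod_single_index (h := fun i k => u i ^ k) (pow_zero _)]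
    induction k with
    | zero => simpa using HomDeg.one
    | succ k ih =>
      rw [pow_succ, Finsupp.single_add, map_add]
      refine ih.mul ?_
      have : wt (Finsupp.single i 1) = i + 1 := by simp [wt, Finsupp.weight_single]
      rw [this]; exact hu i

/-- Discard the monomials of degree greater than `d`. -/
def truncPoly (d : ℕ) (F : MvPolynomial ℕ ℚ) : MvPolynomial ℕ ℚ :=
  ∑ m ∈ F.support with wt m ≤ d, MvPolynomial.monomial m (F.coeff m)

theorem coeff_aeval_truncPoly {u : ℕ → MvPowerSeries ℕ ℚ}
    (hu : ∀ i, HomDeg (i + 1) (u i)) (d : ℕ) (F : MvPolynomial ℕ ℚ) (n : ℕ →₀ ℕ) :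
    coeff n (MvPolynomial.aeval u (truncPoly d F)) =
      if n.degree ≤ d then coeff n (MvPolynomial.aeval u F) else 0 := by
  classical
  conv_rhs => rw [F.as_sum]
  simp only [truncPoly, map_sum, MvPolynomial.aeval_monomial, MvPowerSeries.algebraMap_apply,
    Algebra.algebraMap_self,
    RingHom.id_apply, coeff_C_mul]
  rw [Finset.sum_filter]
  have key (m : ℕ →₀ ℕ) (hm : coeff n (m.prod fun i k => u i ^ k) ≠ 0) : n.degree = wt m := by
    by_contra hne
    exact hm (homDeg_prod hu m n hne)
  split_ifs with hn
  · refine Finset.sum_congr rfl fun m _ => ?_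
    split_ifs with hm
    · rfl
    · have : coeff n (m.prod fun i k => u i ^ k) = 0 := by
        by_contra h0; exact hm (key m h0 ▸ hn)
      rw [this, mul_zero]
  · refine Finset.sum_eq_zero fun m _ => ?_
    split_ifs with hm
    · have : coeff n (m.prod fun i k => u i ^ k) = 0 := by
        by_contra h0; exact hn (key m h0 ▸ hm)
      rw [this, mul_zero]
    · rfl

theorem homDeg_eSeries (i : ℕ) : HomDeg i (eSeries i) := by
  intro n hn
  rw [coeff_eSeries, if_neg fun h1 => hn h1.2]

theorem homDeg_hSeries (i : ℕ) : HomDeg i (hSeries i) := by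
  intro n hn
  rw [coeff_hSeries, if_neg hn]

theorem coe_evalE (F : MvPolynomial ℕ ℚ) :
    (evalE F : MvPowerSeries ℕ ℚ) = MvPolynomial.aeval (fun i => eSeries (i + 1)) F :=
  (Subalgebra.mvPolynomial_aeval_coe _ _ _).symm

theorem coe_evalH (F : MvPolynomial ℕ ℚ) :
    (evalH F : MvPowerSeries ℕ ℚ) = MvPolynomial.aeval (fun i => hSeries (i + 1)) F :=
  (Subalgebra.mvPolynomial_aeval_coe _ _ _).symm

/-- Setting `x_i = 0` for `i ≥ N`. -/
def restr (N : ℕ) : MvPowerSeries ℕ ℚ →ₐ[ℚ] MvPowerSeries (Fin N) ℚ :=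
  killCompl Fin.valEmbedding

theorem coeff_restr (N : ℕ) (f : MvPowerSeries ℕ ℚ) (m : Fin N →₀ ℕ) :
    coeff m (restr N f) = coeff (m.embDomain Fin.valEmbedding) f :=
  coeff_killCompl _ _

theorem sum_single_eq_iff {ι : Type} (t : Finset ι) (m : ι →₀ ℕ) :
    (∑ i ∈ t, Finsupp.single i 1) = m ↔ (∀ i, m i ≤ 1) ∧ m.support = t := by
  classical
  have key (j : ι) : (∑ i ∈ t, Finsupp.single i 1 : ι →₀ ℕ) j = if j ∈ t then 1 else 0 := by
    simp [Finsupp.finsetSum_apply, Finsupp.single_apply]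
  constructor
  · rintro rfl
    refine ⟨fun j => by rw [key]; split_ifs <;> simp, ?_⟩
    ext j
    rw [Finsupp.mem_support_iff, key]; simp
  · rintro ⟨h1, rfl⟩
    ext j
    rw [key]
    have := h1 j
    split_ifs with hj
    · rw [Finsupp.mem_support_iff] at hj; omega
    · rw [Finsupp.notMem_support_iff] at hj; omega

theorem degree_eq_card_support {ι : Type} (m : ι →₀ ℕ) (hm : ∀ i, m i ≤ 1) :
    m.degree = m.support.card := by
  rw [Finsupp.degree_apply, Finset.card_eq_sum_ones]
  refine Finset.sum_congr rfl fun i hi => ?_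
  have := hm i
  rw [Finsupp.mem_support_iff] at hi
  omega

theorem restr_eSeries (N k : ℕ) :
    restr N (eSeries k) = (MvPolynomial.esymm (Fin N) ℚ k : MvPolynomial (Fin N) ℚ) := by
  classical
  ext m
  rw [coeff_restr, coeff_eSeries, MvPolynomial.coeff_coe, MvPolynomial.esymm_eq_sum_monomial,
    MvPolynomial.coeff_sum]
  simp only [MvPolynomial.coeff_monomial, sum_single_eq_iff]
  rw [Finsupp.embDomain_eq_mapDomain, Finsupp.degree_mapDomain]
  have h1 : (∀ i, (m.mapDomain Fin.valEmbedding) i ≤ 1) ↔ ∀ i, m i ≤ 1 := by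
    rw [← Finsupp.embDomain_eq_mapDomain]
    constructor
    · intro H i
      have := H (Fin.valEmbedding i)
      rwa [Finsupp.embDomain_apply_self] at this
    · intro H i
      by_cases hi : i ∈ Set.range (Fin.valEmbedding (n := N))
      · obtain ⟨j, rfl⟩ := hi
        rw [Finsupp.embDomain_apply_self]; exact H j
      · rw [Finsupp.embDomain_of_notMem_range _ _ _ hi]; exact zero_le_one
  rw [h1]
  by_cases hm : ∀ i, m i ≤ 1
  · simp only [hm, implies_true, true_and]
    rw [Finset.sum_ite_eq, degree_eq_card_support m hm]
    simp [Finset.mem_powersetCard]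
  · simp only [hm, false_and, if_false, Finset.sum_const_zero]

theorem restr_aeval_rename (N : ℕ) (G : MvPolynomial (Fin N) ℚ) :
    restr N (MvPolynomial.aeval (fun i => eSeries (i + 1)) (MvPolynomial.rename Fin.val G)) =
      ((MvPolynomial.esymmAlgHom (Fin N) ℚ N G : MvPolynomial (Fin N) ℚ) :
        MvPowerSeries (Fin N) ℚ) := by
  rw [MvPolynomial.esymmAlgHom_apply, MvPolynomial.aeval_rename]
  have : (restr N).comp (MvPolynomial.aeval ((fun i => eSeries (i + 1)) ∘ Fin.val)) =
      (MvPolynomial.coeToMvPowerSeries.algHom ℚ).comp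
        (MvPolynomial.aeval fun i : Fin N => MvPolynomial.esymm (Fin N) ℚ (i + 1)) := by
    ext1 i
    simp [restr_eSeries]
  simpa using DFunLike.congr_fun this G

theorem evalE_injective : Function.Injective evalE := by
  rw [injective_iff_map_eq_zero]
  intro F hF
  obtain ⟨N, hN⟩ : ∃ N, ∀ i ∈ F.vars, i < N :=
    ⟨F.vars.sup id + 1, fun i hi => Nat.lt_succ_of_le (Finset.le_sup (f := id) hi)⟩
  obtain ⟨G, rfl⟩ := MvPolynomial.exists_rename_eq_of_vars_subset_range F
    (Fin.val : Fin N → ℕ) Fin.val_injective (fun i hi => ⟨⟨i, hN i hi⟩, rfl⟩)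
  have h0 : MvPolynomial.aeval (fun i => eSeries (i + 1)) (MvPolynomial.rename Fin.val G) = 0 := by
    rw [← coe_evalE, hF]; rfl
  have h1 := restr_aeval_rename N G
  rw [h0, map_zero] at h1
  have h2 : MvPolynomial.esymmAlgHom (Fin N) ℚ N G = 0 := by
    apply Subtype.ext
    apply MvPolynomial.coe_injective
    rw [← h1]; simp
  have h3 : G = 0 := MvPolynomial.esymmAlgHom_injective ℚ (by simp) (h2.trans (map_zero _).symm)
  rw [h3, map_zero]

/-- A symmetric series of degree at most `d` is determined by its restriction to `d` variables. -/
theorem eq_of_restr_eq {f g : MvPowerSeries ℕ ℚ} (hf : IsSymm f) (hg : IsSymm g) {d : ℕ}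
    (hfd : DegLE d f) (hgd : DegLE d g) (hfg : restr d f = restr d g) : f = g := by
  classical
  ext m
  rcases lt_or_ge d m.degree with hm | hm
  · rw [hfd m hm, hgd m hm]
  have hcard : m.support.card ≤ d := by
    refine le_trans ?_ hm
    rw [Finsupp.degree_apply, Finset.card_eq_sum_ones]
    refine Finset.sum_le_sum fun i hi => ?_
    rw [Finsupp.mem_support_iff] at hi
    omega
  obtain ⟨σ, hσ⟩ : ∃ σ : Equiv.Perm ℕ, ∀ i ∈ m.support, σ i < d := by
    let s : Finset ℕ := m.support ∪ Finset.range d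
    have hA : Fintype.card {x : s // (x : ℕ) ∈ m.support} = m.support.card := by
      rw [← Fintype.card_coe]
      exact Fintype.card_congr
        ⟨fun x => ⟨x.1.1, x.2⟩, fun x => ⟨⟨x.1, Finset.mem_union_left _ x.2⟩, x.2⟩,
          fun _ => rfl, fun _ => rfl⟩
    have hB : Fintype.card {x : s // (x : ℕ) < m.support.card} = m.support.card := by
      conv_rhs => rw [← Fintype.card_fin m.support.card]
      exact Fintype.card_congr
        ⟨fun x => ⟨x.1.1, x.2⟩, fun x => ⟨⟨x.1, Finset.mem_union_right _
          (Finset.mem_range.2 (x.2.trans_le hcard))⟩, x.2⟩, fun _ => rfl, fun _ => rfl⟩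
    let ε := Fintype.equivOfCardEq (hA.trans hB.symm)
    refine ⟨Equiv.Perm.ofSubtype ε.extendSubtype, fun i hi => ?_⟩
    have his : i ∈ s := Finset.mem_union_left _ hi
    rw [Equiv.Perm.ofSubtype_apply_of_mem _ his,
      Equiv.extendSubtype_apply_of_mem ε ⟨i, his⟩ hi]
    exact (ε ⟨⟨i, his⟩, hi⟩).2.trans_le hcard
  rw [← (isSymm_iff f).1 hf σ m, ← (isSymm_iff g).1 hg σ m]
  have hrange : m.mapDomain σ ∈ Set.range (Finsupp.embDomain (M := ℕ) (Fin.valEmbedding (n := d))) := by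
    rw [Finsupp.mem_range_embDomain_iff]
    intro j hj
    have := Finsupp.mapDomain_support hj
    rw [Finset.mem_image] at this
    obtain ⟨i, hi, rfl⟩ := this
    exact ⟨⟨σ i, hσ i hi⟩, rfl⟩
  obtain ⟨n, hn⟩ := hrange
  rw [← hn, ← coeff_restr, ← coeff_restr, hfg]

theorem exists_truncPoly (f : Lam) (d : ℕ) (hd : DegLE d f.1) :
    ∃ F, evalE (truncPoly d F) = f := by
  have hsymm : ∃ q : MvPolynomial (Fin d) ℚ, q.IsSymmetric ∧
      (q : MvPowerSeries (Fin d) ℚ) = restr d f.1 := by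
    let S := (Finsupp.finite_of_degree_le (σ := Fin d) d).toFinset
    let q : MvPolynomial (Fin d) ℚ :=
      ∑ m ∈ S, MvPolynomial.monomial m (coeff m (restr d f.1))
    have hq (m : Fin d →₀ ℕ) : q.coeff m = coeff m (restr d f.1) := by
      classical
      simp only [q, MvPolynomial.coeff_sum, MvPolynomial.coeff_monomial]
      rw [Finset.sum_ite_eq']
      split_ifs with hm
      · rfl
      · have hm' : d < m.degree := by
          by_contra h0
          exact hm (by simpa [S] using h0)
        rw [coeff_restr, hd]
        rwa [Finsupp.embDomain_eq_mapDomain, Finsupp.degree_mapDomain]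
    refine ⟨q, fun σ => ?_, ?_⟩
    · ext m
      have hm : m = (m.mapDomain σ.symm).mapDomain σ := by
        rw [← Finsupp.mapDomain_comp]; simp
      conv_lhs => rw [hm]
      rw [MvPolynomial.coeff_rename_mapDomain _ σ.injective, hq, hq, coeff_restr, coeff_restr,
        ← (isSymm_iff f.1).1 f.2.1 (σ.viaEmbedding Fin.valEmbedding)]
      congr 2
      conv_rhs => rw [hm]
      simp only [Finsupp.embDomain_eq_mapDomain]
      rw [← Finsupp.mapDomain_comp, ← Finsupp.mapDomain_comp]
      congr 1
      funext i
      simp only [Function.comp_apply]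
      rw [Equiv.Perm.viaEmbedding_apply, Equiv.apply_symm_apply]
    · ext m
      rw [MvPolynomial.coeff_coe, hq]
  obtain ⟨q, hq, hqf⟩ := hsymm
  obtain ⟨G, hG⟩ := MvPolynomial.esymmAlgHom_surjective (σ := Fin d) (n := d) ℚ (by simp) ⟨q, hq⟩
  have h1 := restr_aeval_rename d G
  rw [hG] at h1
  refine ⟨MvPolynomial.rename Fin.val G, ?_⟩
  have htr := coeff_aeval_truncPoly (fun i => homDeg_eSeries (i + 1)) d
    (MvPolynomial.rename Fin.val G)
  apply Subtype.ext
  refine eq_of_restr_eq (evalE _).2.1 f.2.1 ?_ hd ?_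
  · intro m hm
    rw [coe_evalE, htr, if_neg (by omega)]
  · ext m
    rw [coe_evalE, coeff_restr, htr, ← coeff_restr, h1]
    simp only [hqf]
    split_ifs with hm
    · rfl
    · rw [coeff_restr, hd _ (by omega)]

theorem evalE_surjective : Function.Surjective evalE := by
  intro f
  obtain ⟨d, hd⟩ := f.2.2
  obtain ⟨F, hF⟩ := exists_truncPoly f d hd
  exact ⟨_, hF⟩

/-- The expression of `h_n` through `e_1, e_2, …`: `Q_0 = 1` and
`Q_{n+1} = ∑_{i ≤ n} (-1)^i X_i Q_{n-i}`, where `X_i` stands for `e_{i+1}`. -/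
def polyQ : ℕ → MvPolynomial ℕ ℚ
  | 0 => 1
  | n + 1 => ∑ i : Fin (n + 1), (-1) ^ (i : ℕ) * MvPolynomial.X (i : ℕ) * polyQ (n - i)

theorem polyQ_succ (n : ℕ) : polyQ (n + 1) =
    ∑ i ∈ Finset.range (n + 1), (-1) ^ i * MvPolynomial.X i * polyQ (n - i) := by
  rw [polyQ, Finset.sum_range]

/-- The relations `∑_{i ≤ n+1} (-1)^i u_i v_{n+1-i} = 0`. -/
def Related {A : Type} [CommRing A] (u v : ℕ → A) : Prop :=
  u 0 = 1 ∧ v 0 = 1 ∧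
    ∀ n, ∑ i ∈ Finset.range (n + 2), (-1) ^ i * u i * v (n + 1 - i) = 0

theorem Related.symm {A : Type} [CommRing A] {u v : ℕ → A} (huv : Related u v) :
    Related v u := by
  refine ⟨huv.2.1, huv.1, fun n => ?_⟩
  have h1 := congrArg (fun x => (-1) ^ (n + 1) * x) (huv.2.2 n)
  simp only [mul_zero] at h1
  rw [← h1, ← Finset.sum_range_reflect, Finset.mul_sum]
  refine Finset.sum_congr rfl fun i hi => ?_
  rw [Finset.mem_range] at hi
  have h2 : n + 2 - 1 - i = n + 1 - i := by omega
  have h3 : n + 1 - (n + 1 - i) = i := by omega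
  have h4 : (-1 : A) ^ (n + 1) = (-1) ^ (n + 1 - i) * (-1) ^ i := by
    rw [← pow_add]; congr 1; omega
  have h5 : (-1 : A) ^ i * (-1) ^ i = 1 := by rw [← mul_pow]; simp
  rw [h2, h3, h4]
  linear_combination (-(-1) ^ (n + 1 - i) * v (n + 1 - i) * u i) * h5

theorem Related.eq_aeval {A : Type} [CommRing A] [Algebra ℚ A] {u v : ℕ → A}
    (huv : Related u v) (n : ℕ) :
    v n = MvPolynomial.aeval (fun i => u (i + 1)) (polyQ n) := by
  induction n using Nat.strong_induction_on with
  | _ n ih =>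
    cases n with
    | zero => rw [polyQ, map_one, huv.2.1]
    | succ n =>
      have h1 := huv.2.2 n
      rw [Finset.sum_range_succ'] at h1
      simp only [pow_zero, one_mul, huv.1, Nat.sub_zero] at h1
      rw [polyQ_succ, map_sum, eq_neg_of_add_eq_zero_right h1, ← Finset.sum_neg_distrib]
      refine Finset.sum_congr rfl fun i hi => ?_
      rw [map_mul, map_mul, map_pow, map_neg, map_one, MvPolynomial.aeval_X,
        ← ih (n - i) (by omega)]
      have : n + 1 - (i + 1) = n - i := by omega
      rw [this, pow_succ]
      ring

/-- The substitution exchanging the `e_n` and the `h_n`. -/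
def exch : MvPolynomial ℕ ℚ →ₐ[ℚ] MvPolynomial ℕ ℚ :=
  MvPolynomial.aeval fun i => polyQ (i + 1)

theorem exch_exch (F : MvPolynomial ℕ ℚ) : exch (exch F) = F := by
  let x : ℕ → MvPolynomial ℕ ℚ := fun n => Nat.casesOn n 1 MvPolynomial.X
  have hx : Related x polyQ := by
    refine ⟨rfl, by rw [polyQ], fun n => ?_⟩
    rw [Finset.sum_range_succ']
    have hx0 : x 0 = 1 := rfl
    have hxs (i : ℕ) : x (i + 1) = MvPolynomial.X i := rfl
    simp only [pow_zero, one_mul, Nat.sub_zero, hx0, hxs]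
    rw [polyQ_succ, ← Finset.sum_add_distrib]
    refine Finset.sum_eq_zero fun i _ => ?_
    have : n + 1 - (i + 1) = n - i := by omega
    rw [this, pow_succ]
    ring
  have key : exch.comp exch = AlgHom.id ℚ _ := by
    ext1 i
    rw [AlgHom.comp_apply]
    have h1 : exch (MvPolynomial.X i) = polyQ (i + 1) := MvPolynomial.aeval_X _ _
    rw [h1]
    exact (hx.symm.eq_aeval (i + 1)).symm
  exact DFunLike.congr_fun key F

theorem related_e_h : Related e h := by
  classical
  have h0 (i : ℕ →₀ ℕ) (hi : i.degree = 0) : i = 0 := (Finsupp.degree_eq_zero_iff i).1 hi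
  refine ⟨?_, ?_, fun n => ?_⟩
  · apply Subtype.ext
    ext m
    change coeff m (eSeries 0) = coeff m 1
    rw [coeff_eSeries, coeff_one]
    refine if_congr ⟨fun H => h0 m H.2, ?_⟩ rfl rfl
    rintro rfl
    simp
  · apply Subtype.ext
    ext m
    change coeff m (hSeries 0) = coeff m 1
    rw [coeff_hSeries, coeff_one]
    refine if_congr ⟨fun H => h0 m H, ?_⟩ rfl rfl
    rintro rfl
    simp
  · apply Subtype.ext
    have hcoe : ((∑ i ∈ Finset.range (n + 2), (-1) ^ i * e i * h (n + 1 - i) : Lam) :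
        MvPowerSeries ℕ ℚ) =
        ∑ i ∈ Finset.range (n + 2), (-1) ^ i * eSeries i * hSeries (n + 1 - i) := by
      simp [e, h]
    rw [hcoe]
    ext m
    have hterm (i : ℕ) (hi : i ∈ Finset.range (n + 2)) :
        coeff m ((-1) ^ i * eSeries i * hSeries (n + 1 - i)) =
        ∑ q ∈ Finset.HasAntidiagonal.antidiagonal m,
          if m.degree = n + 1 ∧ (∀ j, q.1 j ≤ 1) ∧ q.1.degree = i then (-1) ^ i else 0 := by
      have hC : ((-1) ^ i : MvPowerSeries ℕ ℚ) = C ((-1) ^ i) := by simp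
      rw [hC, mul_assoc, coeff_C_mul, coeff_mul, Finset.mul_sum]
      refine Finset.sum_congr rfl fun q hq => ?_
      rw [Finset.HasAntidiagonal.mem_antidiagonal] at hq
      have hd : m.degree = q.1.degree + q.2.degree := by rw [← hq, map_add]
      rw [Finset.mem_range] at hi
      rw [coeff_eSeries, coeff_hSeries]
      by_cases hA : (∀ j, q.1 j ≤ 1) ∧ q.1.degree = i
      · by_cases hB : q.2.degree = n + 1 - i
        · rw [if_pos hA, if_pos hB, if_pos ⟨by omega, hA⟩]; simp
        · rw [if_pos hA, if_neg hB, if_neg]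
          · simp
          · rintro ⟨h1, -, h2⟩; omega
      · rw [if_neg hA, if_neg (fun H => hA H.2 : ¬(m.degree = n + 1 ∧ _))]; simp
    rw [map_sum, Finset.sum_congr rfl hterm, Finset.sum_comm]
    change _ = (0 : ℚ)
    by_cases hm : m.degree = n + 1
    · have hcollapse (q : (ℕ →₀ ℕ) × (ℕ →₀ ℕ))
          (hq : q ∈ Finset.HasAntidiagonal.antidiagonal m) :
          (∑ i ∈ Finset.range (n + 2),
            if m.degree = n + 1 ∧ (∀ j, q.1 j ≤ 1) ∧ q.1.degree = i then (-1 : ℚ) ^ i else 0) =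
          if ∀ j, q.1 j ≤ 1 then (-1 : ℚ) ^ q.1.degree else 0 := by
        rw [Finset.HasAntidiagonal.mem_antidiagonal] at hq
        have hd : m.degree = q.1.degree + q.2.degree := by rw [← hq, map_add]
        simp only [hm, true_and]
        by_cases hA : ∀ j, q.1 j ≤ 1
        · simp only [hA, implies_true, true_and, if_true]
          rw [Finset.sum_ite_eq, if_pos (Finset.mem_range.2 (by omega))]
        · simp only [hA, false_and, if_false, Finset.sum_const_zero]
      rw [Finset.sum_congr rfl hcollapse]
      obtain ⟨j, hj⟩ : ∃ j, m j ≠ 0 := by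
        by_contra H
        push Not at H
        have : m = 0 := Finsupp.ext H
        rw [this, map_zero] at hm
        omega
      rw [← Finset.sum_filter]
      let s : (ℕ →₀ ℕ) := Finsupp.single j 1
      have hsj : s j = 1 := by simp [s]
      have hsk (k : ℕ) (hk : k ≠ j) : s k = 0 := by simp [s, hk.symm]
      have hsd : s.degree = 1 := Finsupp.degree_single _ _
      refine Finset.sum_involution
        (fun q _ => if q.1 j = 0 then (q.1 + s, q.2 - s) else (q.1 - s, q.2 + s)) ?_ ?_ ?_ ?_
      all_goals
        rintro ⟨a, b⟩ hq
        simp only [Finset.mem_filter, Finset.HasAntidiagonal.mem_antidiagonal] at hq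
        obtain ⟨hab, ha⟩ := hq
        have haj := ha j
        have habj : a j + b j = m j := by rw [← hab]; rfl
        dsimp only at ha haj habj ⊢
      · split_ifs with h1
        · rw [map_add, hsd, pow_succ]; ring
        · have : a.degree = (a - s).degree + 1 := by
            rw [← hsd, ← map_add]
            congr 1
            ext k
            by_cases hk : k = j
            · subst hk; simp [hsj]; omega
            · simp [hsk k hk]
          rw [this, pow_succ]; ring
      · intro _
        split_ifs with h1
        · intro H
          have := congrArg (fun q => q.1 j) H
          simp [hsj] at this
        · intro H
          have := congrArg (fun q => q.1 j) H
          simp [hsj] at this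
          omega
      · simp only [Finset.mem_filter, Finset.HasAntidiagonal.mem_antidiagonal]
        split_ifs with h1
        · refine ⟨?_, fun k => ?_⟩
          · rw [← hab]
            ext k
            by_cases hk : k = j
            · subst hk; simp [hsj]; omega
            · simp [hsk k hk]
          · by_cases hk : k = j
            · subst hk; simp [hsj]; omega
            · simpa [hsk k hk] using ha k
        · refine ⟨?_, fun k => ?_⟩
          · rw [← hab]
            ext k
            by_cases hk : k = j
            · subst hk; simp [hsj]; omega
            · simp [hsk k hk]
          · have := ha k
            simp only [Finsupp.coe_tsub, Pi.sub_apply]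
            omega
      · by_cases h1 : a j = 0
        · simp only [h1, if_true]
          rw [if_neg (by simp [hsj])]
          ext k
          · simp
          · by_cases hk : k = j
            · subst hk; simp [hsj]; omega
            · simp [hsk k hk]
        · simp only [h1, if_false]
          rw [if_pos (by simp [hsj]; omega)]
          ext k
          · by_cases hk : k = j
            · subst hk; simp [hsj]; omega
            · simp [hsk k hk]
          · simp
    · refine Finset.sum_eq_zero fun q _ => Finset.sum_eq_zero fun i _ => ?_
      rw [if_neg fun H => hm H.1]

theorem evalH_eq (F : MvPolynomial ℕ ℚ) : evalH F = evalE (exch F) := by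
  have : evalH = evalE.comp exch := by
    ext1 i
    rw [AlgHom.comp_apply, exch, MvPolynomial.aeval_X, evalH, MvPolynomial.aeval_X]
    exact related_e_h.eq_aeval (i + 1)
  exact DFunLike.congr_fun this F

/-- `Λ_ℚ = ℚ[e_1, e_2, …]`, a polynomial ring. -/
def equivE : MvPolynomial ℕ ℚ ≃ₐ[ℚ] Lam :=
  AlgEquiv.ofBijective evalE ⟨evalE_injective, evalE_surjective⟩

/-- `Λ_ℚ = ℚ[h_1, h_2, …]`, a polynomial ring. -/
def equivH : MvPolynomial ℕ ℚ ≃ₐ[ℚ] Lam :=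
  AlgEquiv.ofBijective evalH (by
    have h1 : (evalH : MvPolynomial ℕ ℚ → Lam) = evalE ∘ exch := funext evalH_eq
    have h2 : Function.Bijective exch := Function.Involutive.bijective exch_exch
    rw [h1]
    exact Function.Bijective.comp ⟨evalE_injective, evalE_surjective⟩ h2)

/-! ### The involution `ω` and the scalar product -/

/-- The algebra automorphism `ω` of `Λ_ℚ` with `ω e_n = h_n` for all `n ≥ 1`. -/
def omega : Lam ≃ₐ[ℚ] Lam := equivE.symm.trans equivH

theorem DegLE.omega {d : ℕ} {f : Lam} (hf : DegLE d f.1) : DegLE d (omega f).1 := by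
  obtain ⟨F, rfl⟩ := exists_truncPoly f d hf
  have h1 : SymmFn.omega (evalE (truncPoly d F)) = evalH (truncPoly d F) := by
    rw [SymmFn.omega, AlgEquiv.trans_apply]
    have : equivE.symm (evalE (truncPoly d F)) = truncPoly d F :=
      equivE.symm_apply_apply (truncPoly d F)
    rw [this]; rfl
  intro m hm
  rw [h1, coe_evalH, coeff_aeval_truncPoly (fun i => homDeg_hSeries (i + 1)),
    if_neg (by omega)]

/-- The partition whose number of parts equal to `i + 1` is `m i` for every `i`, as the exponent
vector `(λ_1, λ_2, …, λ_ℓ, 0, 0, …)` with `λ_1 ≥ λ_2 ≥ …`. Thus, for this `λ`, the product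
`∏ h_{i+1} ^ (m i)` is `h_λ`, and `x ^ λ` is the leading monomial of the monomial symmetric
function `m_λ`. -/
def shape (m : ℕ →₀ ℕ) : ℕ →₀ ℕ :=
  (((Finsupp.toMultiset m).map (· + 1)).sort (· ≥ ·)).toFinsupp

/-- The (Hall) scalar product on `Λ_ℚ`, that is, the bilinear form with `⟨m_λ, h_μ⟩ = δ_{λμ}`.
If `f = ∑ a_λ m_λ` (so that `a_λ` is the coefficient of `x ^ λ` in `f`) and `g = ∑ b_λ h_λ`, then
`⟨f, g⟩ = ∑ a_λ b_λ`. -/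
def hall (f g : Lam) : ℚ :=
  ∑ m ∈ (equivH.symm g).support, coeff (shape m) f.1 * (equivH.symm g).coeff m

/-! ### Superfication and shiftification -/

/-- `f(x, y)`: the symmetric function `f` in the disjoint union of two alphabets `x` (`Sum.inl`)
and `y` (`Sum.inr`). -/
def twoAlphabets (f : Lam) : MvPowerSeries (ℕ ⊕ ℕ) ℚ :=
  rename Equiv.natSumNatEquivNat.symm f.1

theorem coeff_twoAlphabets (f : Lam) (m : ℕ ⊕ ℕ →₀ ℕ) :
    coeff m (twoAlphabets f) = coeff (m.mapDomain Equiv.natSumNatEquivNat) f.1 := by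
  have h1 := coeff_embDomain_rename (R := ℚ) Equiv.natSumNatEquivNat.symm.toEmbedding f.1
    (m.mapDomain Equiv.natSumNatEquivNat)
  rw [Finsupp.embDomain_eq_mapDomain, ← Finsupp.mapDomain_comp] at h1
  rw [← h1]
  have h2 : (Equiv.natSumNatEquivNat.symm.toEmbedding : ℕ → ℕ ⊕ ℕ) ∘
      (Equiv.natSumNatEquivNat : ℕ ⊕ ℕ → ℕ) = id :=
    funext fun i => Equiv.natSumNatEquivNat.symm_apply_apply i
  rw [h2, Finsupp.mapDomain_id]
  rfl

theorem coeff_twoAlphabets_perm (f : Lam) (τ : Equiv.Perm (ℕ ⊕ ℕ)) (m : ℕ ⊕ ℕ →₀ ℕ) :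
    coeff (m.mapDomain τ) (twoAlphabets f) = coeff m (twoAlphabets f) := by
  rw [coeff_twoAlphabets, coeff_twoAlphabets,
    ← (isSymm_iff f.1).1 f.2.1 (Equiv.natSumNatEquivNat.permCongr τ)
      (m.mapDomain Equiv.natSumNatEquivNat), ← Finsupp.mapDomain_comp, ← Finsupp.mapDomain_comp]
  congr 2
  refine congrArg (Finsupp.mapDomain · m) (funext fun i => ?_)
  simp only [Function.comp_apply, Equiv.permCongr_apply, Equiv.symm_apply_apply]

/-- The monomial `x ^ a * y ^ b`, as an exponent vector. -/
def joinExp (a b : ℕ →₀ ℕ) : ℕ ⊕ ℕ →₀ ℕ := a.mapDomain Sum.inl + b.mapDomain Sum.inr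

theorem mapDomain_joinExp (σ τ : Equiv.Perm ℕ) (a b : ℕ →₀ ℕ) :
    (joinExp a b).mapDomain (Equiv.sumCongr σ τ) =
      joinExp (a.mapDomain σ) (b.mapDomain τ) := by
  simp only [joinExp, Finsupp.mapDomain_add, ← Finsupp.mapDomain_comp]
  rfl

theorem degree_joinExp (a b : ℕ →₀ ℕ) : (joinExp a b).degree = a.degree + b.degree := by
  rw [joinExp, map_add, Finsupp.degree_mapDomain, Finsupp.degree_mapDomain]

/-- The coefficient of `x ^ a` in `f(x, y)`, as a power series in `y`. -/
def ySeries (f : Lam) (a : ℕ →₀ ℕ) : MvPowerSeries ℕ ℚ :=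
  fun b => coeff (joinExp a b) (twoAlphabets f)

theorem coeff_ySeries (f : Lam) (a b : ℕ →₀ ℕ) :
    coeff b (ySeries f a) = coeff (joinExp a b) (twoAlphabets f) := rfl

theorem degLE_ySeries {f : Lam} {d : ℕ} (hd : DegLE d f.1) (a : ℕ →₀ ℕ) :
    DegLE (d - a.degree) (ySeries f a) := by
  intro b hb
  rw [coeff_ySeries, coeff_twoAlphabets, hd]
  rw [Finsupp.degree_mapDomain, degree_joinExp]
  omega

theorem ySeries_mem (f : Lam) (a : ℕ →₀ ℕ) : ySeries f a ∈ Lam := by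
  obtain ⟨d, hd⟩ := f.2.2
  refine ⟨(isSymm_iff _).2 fun σ b => ?_, _, degLE_ySeries hd a⟩
  have h1 := mapDomain_joinExp 1 σ a b
  rw [Equiv.Perm.coe_one, Finsupp.mapDomain_id] at h1
  rw [coeff_ySeries, coeff_ySeries, ← h1, coeff_twoAlphabets_perm]

/-- The coefficient of `x ^ a` in `f(x, y)`, as a symmetric function in `y`. -/
def yCoeff (f : Lam) (a : ℕ →₀ ℕ) : Lam := ⟨ySeries f a, ySeries_mem f a⟩

/-- The superfication `f(x/y) = ω_y f(x, y)`: the involution `ω` is applied to `f(x, y)` as a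
symmetric function in `y` with coefficients depending on `x`. -/
def superfication (f : Lam) : MvPowerSeries (ℕ ⊕ ℕ) ℚ := fun m =>
  coeff (m.comapDomain Sum.inr Sum.inr_injective.injOn)
    (omega (yCoeff f (m.comapDomain Sum.inl Sum.inl_injective.injOn))).1

theorem joinExp_inl (a b : ℕ →₀ ℕ) (i : ℕ) : joinExp a b (Sum.inl i) = a i := by
  rw [joinExp, Finsupp.add_apply, Finsupp.mapDomain_apply Sum.inl_injective,
    Finsupp.mapDomain_of_notMem_range _ _ (by simp), add_zero]

theorem joinExp_inr (a b : ℕ →₀ ℕ) (i : ℕ) : joinExp a b (Sum.inr i) = b i := by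
  rw [joinExp, Finsupp.add_apply, Finsupp.mapDomain_apply Sum.inr_injective,
    Finsupp.mapDomain_of_notMem_range _ _ (by simp), zero_add]

theorem exists_joinExp (m : ℕ ⊕ ℕ →₀ ℕ) : ∃ a b, m = joinExp a b := by
  refine ⟨m.comapDomain Sum.inl Sum.inl_injective.injOn,
    m.comapDomain Sum.inr Sum.inr_injective.injOn, ?_⟩
  ext (i | i)
  · rw [joinExp_inl, Finsupp.comapDomain_apply]
  · rw [joinExp_inr, Finsupp.comapDomain_apply]

theorem coeff_superfication (f : Lam) (a b : ℕ →₀ ℕ) :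
    coeff (joinExp a b) (superfication f) = coeff b (omega (yCoeff f a)).1 := by
  have h1 : (joinExp a b).comapDomain Sum.inl Sum.inl_injective.injOn = a := by
    ext i
    rw [Finsupp.comapDomain_apply, joinExp_inl]
  have h2 : (joinExp a b).comapDomain Sum.inr Sum.inr_injective.injOn = b := by
    ext i
    rw [Finsupp.comapDomain_apply, joinExp_inr]
  change coeff ((joinExp a b).comapDomain Sum.inr Sum.inr_injective.injOn)
    (omega (yCoeff f ((joinExp a b).comapDomain Sum.inl Sum.inl_injective.injOn))).1 = _
  rw [h1, h2]

instance tendstoCofinite_fold :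
    Filter.TendstoCofinite (Sum.elim id id : ℕ ⊕ ℕ → ℕ) := by
  rw [Filter.tendstoCofinite_iff_finite_preimage_singleton]
  intro i
  refine (Set.toFinite {Sum.inl i, Sum.inr i}).subset ?_
  rintro (j | j) hj <;> simp_all

/-- The power series `f(x/x)`, obtained from `f(x/y)` by setting `y_i = x_i` for all `i`. -/
def shiftSeries (f : Lam) : MvPowerSeries ℕ ℚ :=
  rename (Sum.elim id id) (superfication f)

theorem rename_sumCongr_superfication (f : Lam) (σ : Equiv.Perm ℕ) :
    rename (Equiv.sumCongr σ σ) (superfication f) = superfication f := by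
  have key (m : ℕ ⊕ ℕ →₀ ℕ) :
      coeff (m.mapDomain (Equiv.sumCongr σ σ)) (superfication f) =
        coeff m (superfication f) := by
    obtain ⟨a, b, rfl⟩ := exists_joinExp m
    rw [mapDomain_joinExp, coeff_superfication, coeff_superfication]
    have h1 : yCoeff f (a.mapDomain σ) = yCoeff f a := by
      apply Subtype.ext
      ext c
      have h2 := mapDomain_joinExp σ 1 a c
      rw [Equiv.Perm.coe_one, Finsupp.mapDomain_id] at h2
      change coeff (joinExp _ _) (twoAlphabets f) = coeff (joinExp _ _) (twoAlphabets f)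
      rw [← h2, coeff_twoAlphabets_perm]
    rw [h1, (isSymm_iff _).1 (omega (yCoeff f a)).2.1]
  ext m
  have hm : m = (m.mapDomain (Equiv.sumCongr σ σ).symm).mapDomain (Equiv.sumCongr σ σ) := by
    rw [← Finsupp.mapDomain_comp, Equiv.self_comp_symm, Finsupp.mapDomain_id]
  have h1 := coeff_embDomain_rename (R := ℚ) (Equiv.sumCongr σ σ).toEmbedding (superfication f)
    (m.mapDomain (Equiv.sumCongr σ σ).symm)
  have h2 := key (m.mapDomain (Equiv.sumCongr σ σ).symm)
  rw [← hm] at h2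
  rw [h2, ← h1, Finsupp.embDomain_eq_mapDomain]
  conv_lhs => rw [hm]
  rfl

theorem shiftSeries_mem (f : Lam) : shiftSeries f ∈ Lam := by
  obtain ⟨d, hd⟩ := f.2.2
  refine ⟨fun σ => ?_, d, fun m hm => ?_⟩
  · rw [shiftSeries]
    conv_rhs => rw [← rename_sumCongr_superfication f σ]
    rw [rename_rename, rename_rename]
    congr 2
    funext i
    rcases i with i | i <;> rfl
  · rw [shiftSeries, coeff_rename]
    refine Finset.sum_eq_zero fun n hn => ?_
    rw [Set.Finite.mem_toFinset, Set.mem_preimage, Set.mem_singleton_iff] at hn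
    rw [← hn, Finsupp.degree_mapDomain] at hm
    obtain ⟨a, b, rfl⟩ := exists_joinExp n
    rw [coeff_superfication]
    rw [degree_joinExp] at hm
    by_cases ha : a.degree ≤ d
    · exact (DegLE.omega (f := yCoeff f a) (degLE_ySeries hd a)) b (by omega)
    · have h0 : yCoeff f a = 0 := by
        apply Subtype.ext
        ext c
        change coeff (joinExp a c) (twoAlphabets f) = 0
        rw [coeff_twoAlphabets, hd]
        rw [Finsupp.degree_mapDomain, degree_joinExp]
        omega
      rw [h0, map_zero]
      rfl

/-- The shiftification `f(x/x)` of a symmetric function `f`. -/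
def shiftification (f : Lam) : Lam := ⟨shiftSeries f, shiftSeries_mem f⟩

/-! ### Parking functions and the symmetric functions `pf_n` and `sh_n` -/

/-- A parking function of length `n`: a sequence of `n` positive integers whose weakly increasing
rearrangement `b_1 ≤ ⋯ ≤ b_n` satisfies `b_i ≤ i`. -/
def IsParking {n : ℕ} (a : Fin n → ℕ) : Prop :=
  (∀ i, 1 ≤ a i) ∧ ∀ i : Fin n, (a ∘ Tuple.sort a) i ≤ (i : ℕ) + 1

/-- The set of all parking functions of length `n`. -/
def ParkingFunction (n : ℕ) : Type := {a : Fin n → ℕ // IsParking a}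

theorem IsParking.comp_perm {n : ℕ} {a : Fin n → ℕ} (ha : IsParking a)
    (σ : Equiv.Perm (Fin n)) : IsParking (a ∘ σ) :=
  ⟨fun i => ha.1 (σ i), fun i => by
    rw [Tuple.comp_perm_comp_sort_eq_comp_sort]
    exact ha.2 i⟩

/-- The symmetric group acts on parking functions by permuting coordinates:
`(w • a) i = a (w⁻¹ i)`. -/
instance (n : ℕ) : MulAction (Equiv.Perm (Fin n)) (ParkingFunction n) where
  smul w a := ⟨a.1 ∘ (w⁻¹ : Equiv.Perm (Fin n)), a.2.comp_perm _⟩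
  one_smul _ := rfl
  mul_smul v w a := Subtype.ext (by
    change a.1 ∘ ((v * w)⁻¹ : Equiv.Perm (Fin n)) = (a.1 ∘ (w⁻¹ : Equiv.Perm (Fin n))) ∘ (v⁻¹ : Equiv.Perm (Fin n))
    rw [mul_inv_rev]
    rfl)

/-- The power sum `p_λ`, where `λ` is the cycle type of `w` (with fixed points as parts `1`). -/
def pCycleType {n : ℕ} (w : Equiv.Perm (Fin n)) : Lam := (w.partition.parts.map p).prod

/-- The Frobenius characteristic `ch χ = (1 / n!) ∑_w χ(w) p_{type w}` of a function `χ` on the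
symmetric group. -/
def frobenius {n : ℕ} (χ : Equiv.Perm (Fin n) → ℚ) : Lam :=
  (n.factorial : ℚ)⁻¹ • ∑ w : Equiv.Perm (Fin n), χ w • pCycleType w

/-- The parking function symmetric function `pf_n`: the Frobenius characteristic of the
permutation representation of the symmetric group on parking functions of length `n`. -/
def pf (n : ℕ) : Lam :=
  frobenius (Representation.ofMulAction ℚ (Equiv.Perm (Fin n)) (ParkingFunction n)).character

/-- The shifted parking function symmetric function `sh_n = pf_n(x/x)`. -/
def sh (n : ℕ) : Lam := shiftification (pf n)

end

end SymmFn

namespace SymmFn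

open MvPowerSeries

/-! ### Coefficients at squarefree monomials -/

/-! Everything is read off from squarefree coefficients. Since `p_1 ^ n = h_1 ^ n` is the single
basis element `h_λ` with `λ = (1, …, 1)`, duality makes `⟨f, p_1 ^ n⟩` the coefficient of `x_0 ⋯
x_{n-1}` in `f` (`hall_p_one_pow`).

Shiftification multiplies this coefficient by `2 ^ n` (`coeff_shiftification_of_sqfree`). The series
`e_k` and `h_k` agree at squarefree monomials, and a squarefree coefficient of a product involves
only squarefree coefficients of the factors, so `ω` does not change such coefficients. Thus `f(x/y)`
and `f(x, y)` agree there. After setting `y = x`, each of the `n` variables may come from either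
alphabet, and all `2 ^ n` choices contribute the same coefficient of `f`.

For a Frobenius characteristic, only the identity permutation contributes to this coefficient, which
is therefore `χ 1` (`coeff_frobenius_of_sqfree`). For `pf_n` this is the number of parking
functions. Pollak's circle argument counts them: each of the `(n + 1) ^ n` maps to `ZMod (n + 1)`
has exactly one rotation that is a parking function (`existsUnique_rotation`), by a cycle lemma
(`existsUnique_start`). -/

/-- A monomial all of whose exponents are at most `1`. -/
def Sqfree (m : ℕ →₀ ℕ) : Prop := ∀ i, m i ≤ 1

theorem Sqfree.mono {a m : ℕ →₀ ℕ} (hm : Sqfree m) (h : a ≤ m) : Sqfree a :=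
  fun i => (h i).trans (hm i)

theorem Sqfree.sum_single {m : ℕ →₀ ℕ} (hm : Sqfree m) :
    ∑ i ∈ m.support, Finsupp.single i 1 = m :=
  (sum_single_eq_iff _ _).2 ⟨hm, rfl⟩

/-- The permutations act transitively on the squarefree monomials of a given degree. -/
theorem Sqfree.exists_perm {m m' : ℕ →₀ ℕ} (hm : Sqfree m) (hm' : Sqfree m')
    (hd : m.degree = m'.degree) : ∃ σ : Equiv.Perm ℕ, m.mapDomain σ = m' := by
  have hc : m'.support.card = m.support.card := by
    rw [← degree_eq_card_support m hm, ← degree_eq_card_support m' hm', hd]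
  -- Multiple transitivity of the permutations of `ℕ` carries one support, listed in increasing
  -- order, to the other.
  obtain ⟨σ, hσ⟩ := (Equiv.Perm.isMultiplyPretransitive ℕ m.support.card).exists_smul_eq
    (m.support.orderEmbOfFin rfl).toEmbedding (m'.support.orderEmbOfFin hc).toEmbedding
  have key (i : Fin m.support.card) :
      σ (m.support.orderEmbOfFin rfl i) = m'.support.orderEmbOfFin hc i :=
    DFunLike.congr_fun hσ i
  refine ⟨σ, ?_⟩
  conv_lhs => rw [← hm.sum_single]
  conv_rhs => rw [← hm'.sum_single]
  rw [Finsupp.mapDomain_finsetSum]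
  simp only [Finsupp.mapDomain_single]
  rw [← Finset.map_orderEmbOfFin_univ m.support rfl, ← Finset.map_orderEmbOfFin_univ m'.support hc,
    Finset.sum_map, Finset.sum_map]
  exact Finset.sum_congr rfl fun i _ => congrArg (Finsupp.single · 1) (key i)

theorem coeff_eq_of_sqfree (f : Lam) {m m' : ℕ →₀ ℕ} (hm : Sqfree m) (hm' : Sqfree m')
    (hd : m.degree = m'.degree) : coeff m f.1 = coeff m' f.1 := by
  obtain ⟨σ, rfl⟩ := hm.exists_perm hm' hd
  exact ((isSymm_iff f.1).1 f.2.1 σ m).symm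

theorem omega_evalE (F : MvPolynomial ℕ ℚ) : omega (evalE F) = evalH F := by
  have : equivE.symm (evalE F) = F := equivE.symm_apply_apply F
  rw [omega, AlgEquiv.trans_apply, this]
  rfl

/-- The involution `ω` preserves the coefficients of the squarefree monomials. -/
theorem coeff_omega_of_sqfree (g : Lam) {m : ℕ →₀ ℕ} (hm : Sqfree m) :
    coeff m (omega g).1 = coeff m g.1 := by
  classical
  obtain ⟨F, rfl⟩ := evalE_surjective g
  rw [omega_evalE, coe_evalE, coe_evalH]
  -- `ω` replaces `e_{i+1}` by `h_{i+1}` in the same polynomial `F`. The monomial must vary, since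
  -- the coefficient of a product involves the divisors of `m`, which are again squarefree.
  induction F using MvPolynomial.induction_on generalizing m with
  | C a => simp only [MvPolynomial.aeval_C]
  | add F G hF hG => rw [map_add, map_add, map_add, map_add, hF hm, hG hm]
  | mul_X F i hF =>
    rw [map_mul (MvPolynomial.aeval _), map_mul (MvPolynomial.aeval _), MvPolynomial.aeval_X,
      MvPolynomial.aeval_X, coeff_mul, coeff_mul]
    refine Finset.sum_congr rfl fun q hq => ?_
    rw [Finset.HasAntidiagonal.mem_antidiagonal] at hq
    have h1 : Sqfree q.1 := hm.mono (hq ▸ le_self_add)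
    have h2 : Sqfree q.2 := hm.mono (hq ▸ le_add_self)
    rw [hF h1, coeff_eSeries, coeff_hSeries]
    congr 1
    exact if_congr ⟨fun H => ⟨h2, H⟩, fun H => H.2⟩ rfl rfl

/-- The `y`-part `b` is squarefree, so `ω` can be dropped. What is left is a coefficient of `f` at a
squarefree monomial in the two alphabets, which by symmetry depends only on the degree. -/
theorem coeff_superfication_of_sqfree (f : Lam) {a b m : ℕ →₀ ℕ} (hm : Sqfree m)
    (hab : a + b = m) : coeff (joinExp a b) (superfication f) = coeff m f.1 := by
  have ha : Sqfree a := hm.mono (hab ▸ le_self_add)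
  have hb : Sqfree b := hm.mono (hab ▸ le_add_self)
  rw [coeff_superfication, coeff_omega_of_sqfree _ hb]
  change coeff (joinExp a b) (twoAlphabets f) = _
  rw [coeff_twoAlphabets]
  refine coeff_eq_of_sqfree f (fun i => ?_) hm ?_
  · obtain ⟨j, rfl⟩ := Equiv.natSumNatEquivNat.surjective i
    rw [Finsupp.mapDomain_apply Equiv.natSumNatEquivNat.injective]
    rcases j with j | j
    · rw [joinExp_inl]; exact ha j
    · rw [joinExp_inr]; exact hb j
  · rw [Finsupp.degree_mapDomain, degree_joinExp, ← hab, map_add]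

theorem mapDomain_fold_joinExp (a b : ℕ →₀ ℕ) :
    (joinExp a b).mapDomain (Sum.elim id id) = a + b := by
  rw [joinExp, Finsupp.mapDomain_add, ← Finsupp.mapDomain_comp, ← Finsupp.mapDomain_comp,
    Sum.elim_comp_inl, Sum.elim_comp_inr, Finsupp.mapDomain_id, Finsupp.mapDomain_id]

theorem joinExp_injective {a b a' b' : ℕ →₀ ℕ} (h : joinExp a b = joinExp a' b') :
    a = a' ∧ b = b' := by
  constructor <;> ext i
  · rw [← joinExp_inl a b, h, joinExp_inl]
  · rw [← joinExp_inr a b, h, joinExp_inr]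

theorem Sqfree.card_Iic {m : ℕ →₀ ℕ} (hm : Sqfree m) :
    (Finset.Iic m).card = 2 ^ m.degree := by
  rw [Finsupp.card_Iic, degree_eq_card_support m hm, ← Finset.prod_const]
  refine Finset.prod_congr rfl fun i hi => ?_
  have := hm i
  rw [Finsupp.mem_support_iff] at hi
  rw [Nat.card_Iic]
  omega

/-- The monomials in two alphabets that fold to `m` are `x ^ a * y ^ (m - a)` for the divisors `a`
of `m`. A divisor is a subset of the support, and every one contributes the same coefficient. -/
theorem coeff_shiftification_of_sqfree (f : Lam) {m : ℕ →₀ ℕ} (hm : Sqfree m) :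
    coeff m (shiftification f).1 = 2 ^ m.degree * coeff m f.1 := by
  change coeff m (rename (Sum.elim id id) (superfication f)) = _
  rw [coeff_rename]
  have hbij : ∑ _a ∈ Finset.Iic m, coeff m f.1 = ∑ n ∈ (Filter.TendstoCofinite.finite_preimage_singleton
      (Finsupp.mapDomain (M := ℕ) (Sum.elim id id : ℕ ⊕ ℕ → ℕ)) m).toFinset,
      coeff n (superfication f) := by
    refine Finset.sum_bij (fun a _ => joinExp a (m - a)) ?_ ?_ ?_ ?_
    · intro a ha
      rw [Finset.mem_Iic] at ha
      rw [Set.Finite.mem_toFinset, Set.mem_preimage, Set.mem_singleton_iff,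
        mapDomain_fold_joinExp, add_tsub_cancel_of_le ha]
    · intro a _ a' _ h
      exact (joinExp_injective h).1
    · intro n hn
      rw [Set.Finite.mem_toFinset, Set.mem_preimage, Set.mem_singleton_iff] at hn
      obtain ⟨a, b, rfl⟩ := exists_joinExp n
      rw [mapDomain_fold_joinExp] at hn
      refine ⟨a, Finset.mem_Iic.2 (hn ▸ le_self_add), ?_⟩
      rw [← hn, add_tsub_cancel_left]
    · intro a ha
      rw [Finset.mem_Iic] at ha
      exact (coeff_superfication_of_sqfree f hm (add_tsub_cancel_of_le ha)).symm
  rw [← hbij, Finset.sum_const, hm.card_Iic, nsmul_eq_mul]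
  push_cast
  rfl

/-! ### The scalar product with `p_1 ^ n` -/

/-- Needed because `hall` expands its second argument in the products of the `h_k`. -/
theorem p_one : p 1 = h 1 := by
  classical
  apply Subtype.ext
  ext m
  change coeff m (pSeries 1) = coeff m (hSeries 1)
  rw [coeff_pSeries, coeff_hSeries]
  refine if_congr ⟨?_, fun hm => ?_⟩ rfl rfl
  · rintro ⟨i, rfl⟩
    exact Finsupp.degree_single _ _
  · have hm' : m ∈ Set.range fun i : ℕ => Finsupp.single i 1 := by
      rw [Finsupp.range_single_one]
      exact hm
    exact hm'.imp fun _ => Eq.symm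

/-- The monomial `x_0 ⋯ x_{n-1}`. -/
noncomputable def fullExp (n : ℕ) : ℕ →₀ ℕ := ∑ i ∈ Finset.range n, Finsupp.single i 1

theorem sqfree_fullExp (n : ℕ) : Sqfree (fullExp n) :=
  ((sum_single_eq_iff _ _).1 rfl).1

theorem degree_fullExp (n : ℕ) : (fullExp n).degree = n := by
  simp [fullExp, Finsupp.degree_single]

theorem shape_single (n : ℕ) : shape (Finsupp.single 0 n) = fullExp n := by
  have hs : ((Finsupp.toMultiset (Finsupp.single 0 n)).map (· + 1)).sort (· ≥ ·) =
      List.replicate n 1 := by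
    rw [Finsupp.toMultiset_single, Multiset.nsmul_singleton, Multiset.map_replicate,
      ← Multiset.coe_replicate, Multiset.coe_sort]
    -- The index `0` stands for the part `1`, so `n` copies of it give the partition `(1, …, 1)`, a
    -- list that is already sorted.
    exact List.mergeSort_eq_self _ (by simp [List.pairwise_replicate])
  ext i
  rw [shape, List.toFinsupp_apply, hs, fullExp]
  simp only [Finsupp.finsetSum_apply, Finsupp.single_apply, Finset.sum_ite_eq', Finset.mem_range]
  split_ifs with hi
  · simp [hi]
  · simp [hi]

theorem hall_p_one_pow (f : Lam) (n : ℕ) : hall f (p 1 ^ n) = coeff (fullExp n) f.1 := by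
  classical
  have h1 : equivH (MvPolynomial.monomial (Finsupp.single 0 n) 1) = p 1 ^ n := by
    change evalH _ = _
    rw [← MvPolynomial.X_pow_eq_monomial, map_pow, evalH, MvPolynomial.aeval_X, p_one]
  have h2 : equivH.symm (p 1 ^ n) = MvPolynomial.monomial (Finsupp.single 0 n) 1 := by
    rw [← h1, AlgEquiv.symm_apply_apply]
  rw [hall, h2, MvPolynomial.support_monomial, if_neg one_ne_zero, Finset.sum_singleton,
    MvPolynomial.coeff_monomial, if_pos rfl, mul_one, shape_single]

/-! ### The Frobenius characteristic -/

theorem coeff_pSeries_one_mul (g : MvPowerSeries ℕ ℚ) (m : ℕ →₀ ℕ) :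
    coeff m (pSeries 1 * g) = ∑ i ∈ m.support, coeff (m - Finsupp.single i 1) g := by
  classical
  rw [coeff_mul]
  symm
  have hle {i : ℕ} (hi : i ∈ m.support) : Finsupp.single i 1 ≤ m := by
    rw [Finsupp.single_le_iff]
    exact Nat.one_le_iff_ne_zero.2 (Finsupp.mem_support_iff.1 hi)
  refine Finset.sum_of_injOn (fun i => (Finsupp.single i 1, m - Finsupp.single i 1)) ?_ ?_ ?_ ?_
  · intro i _ j _ hij
    exact Finsupp.single_left_injective one_ne_zero (Prod.ext_iff.1 hij).1
  · intro i hi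
    exact Finset.HasAntidiagonal.mem_antidiagonal.2 (add_tsub_cancel_of_le (hle hi))
  · intro q hq hq'
    rw [Finset.HasAntidiagonal.mem_antidiagonal] at hq
    rw [coeff_pSeries, if_neg, zero_mul]
    rintro ⟨i, hi⟩
    refine hq' ⟨i, ?_, ?_⟩
    · rw [Finset.mem_coe, Finsupp.mem_support_iff, ← hq, hi]
      simp
    · ext1
      · exact hi.symm
      · change m - Finsupp.single i 1 = q.2
        rw [← hi, ← hq, add_tsub_cancel_left]
  · intro i _
    rw [coeff_pSeries, if_pos ⟨i, rfl⟩, one_mul]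

/-- The `n` factors contribute the `n` distinct variables of `m` in any order; the induction removes
the variable taken from the first factor. -/
theorem coeff_pSeries_one_pow (n : ℕ) {m : ℕ →₀ ℕ} (hm : Sqfree m) (hd : m.degree = n) :
    coeff m (pSeries 1 ^ n) = n.factorial := by
  classical
  induction n generalizing m with
  | zero =>
    rw [Finsupp.degree_eq_zero_iff] at hd
    simp [hd]
  | succ n ih =>
    rw [pow_succ', coeff_pSeries_one_mul]
    have key : ∀ i ∈ m.support,
        coeff (m - Finsupp.single i 1) (pSeries 1 ^ n) = (n.factorial : ℚ) := by
      intro i hi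
      refine ih (hm.mono tsub_le_self) ?_
      have h1 : m - Finsupp.single i 1 + Finsupp.single i 1 = m := by
        refine tsub_add_cancel_of_le (Finsupp.single_le_iff.2 ?_)
        exact Nat.one_le_iff_ne_zero.2 (Finsupp.mem_support_iff.1 hi)
      have h2 := congrArg Finsupp.degree h1
      rw [map_add, Finsupp.degree_single, hd] at h2
      omega
    rw [Finset.sum_congr rfl key, Finset.sum_const, ← degree_eq_card_support m hm, hd,
      nsmul_eq_mul, Nat.factorial_succ, Nat.cast_mul]

/-- Every monomial of the product is divisible by some `x_i ^ k` with `k ≥ 2`. -/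
theorem coeff_pSeries_mul_of_sqfree {k : ℕ} (hk : 2 ≤ k) (g : MvPowerSeries ℕ ℚ) {m : ℕ →₀ ℕ}
    (hm : Sqfree m) : coeff m (pSeries k * g) = 0 := by
  classical
  rw [coeff_mul]
  refine Finset.sum_eq_zero fun q hq => ?_
  rw [Finset.HasAntidiagonal.mem_antidiagonal] at hq
  rw [coeff_pSeries, if_neg, zero_mul]
  rintro ⟨i, hi⟩
  have h1 := hm.mono (a := q.1) (hq ▸ le_self_add) i
  rw [hi, Finsupp.single_eq_same] at h1
  omega

/-- A nonidentity permutation has a cycle of length `k ≥ 2`, and the factor `p_k` kills the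
squarefree coefficients. The identity gives `p_1 ^ n`. -/
theorem coeff_pCycleType_of_sqfree {n : ℕ} (w : Equiv.Perm (Fin n)) {m : ℕ →₀ ℕ}
    (hm : Sqfree m) (hd : m.degree = n) :
    coeff m (pCycleType w).1 = if w = 1 then (n.factorial : ℚ) else 0 := by
  split_ifs with hw
  · subst hw
    have : pCycleType (1 : Equiv.Perm (Fin n)) = p 1 ^ n := by
      simp [pCycleType, Equiv.Perm.parts_partition]
    rw [this]
    exact coeff_pSeries_one_pow n hm hd
  · obtain ⟨k, hk⟩ := Multiset.exists_mem_of_ne_zero (mt Equiv.Perm.cycleType_eq_zero.1 hw)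
    have hk' : k ∈ w.partition.parts := by
      rw [Equiv.Perm.parts_partition]
      exact Multiset.mem_add.2 (Or.inl hk)
    obtain ⟨t, ht⟩ := Multiset.exists_cons_of_mem hk'
    rw [pCycleType, ht, Multiset.map_cons, Multiset.prod_cons]
    exact coeff_pSeries_mul_of_sqfree (Equiv.Perm.two_le_of_mem_cycleType hk) _ hm

/-- The dimension of a class function is its value at the identity. -/
theorem coeff_frobenius_of_sqfree {n : ℕ} (χ : Equiv.Perm (Fin n) → ℚ) {m : ℕ →₀ ℕ}
    (hm : Sqfree m) (hd : m.degree = n) : coeff m (frobenius χ).1 = χ 1 := by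
  classical
  have hcoe : (frobenius χ).1 =
      (n.factorial : ℚ)⁻¹ • ∑ w : Equiv.Perm (Fin n), χ w • (pCycleType w).1 := by
    rw [frobenius]
    simp
  rw [hcoe, map_smul, map_sum]
  simp only [map_smul, coeff_pCycleType_of_sqfree _ hm hd, smul_eq_mul, mul_ite, mul_zero]
  rw [Finset.sum_ite_eq', if_pos (Finset.mem_univ _)]
  -- The `n!` contributed by the identity cancels the normalisation.
  field_simp

/-! ### The number of parking functions -/

/-- In a sorted sequence `b_j ≤ j` holds exactly when at least `j` entries are at most `j`. This
form removes the sorting and can be expressed by partial sums around a circle. -/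
theorem isParking_iff {n : ℕ} (a : Fin n → ℕ) :
    IsParking a ↔ (∀ i, 1 ≤ a i) ∧
      ∀ j ≤ n, j ≤ (Finset.univ.filter fun i => a i ≤ j).card := by
  refine and_congr_right fun _ => ?_
  have hcard (x : ℕ) : (Finset.univ.filter fun i => (a ∘ Tuple.sort a) i ≤ x).card =
      (Finset.univ.filter fun i => a i ≤ x).card :=
    Finset.card_bij (fun i _ => Tuple.sort a i) (by simp)
      (fun _ _ _ _ h => (Tuple.sort a).injective h)
      (fun b hb => ⟨(Tuple.sort a).symm b, by simpa using hb, by simp⟩)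
  have key (i : Fin n) (x : ℕ) :=
    Tuple.lt_card_le_iff_apply_le_of_monotone (f := a ∘ Tuple.sort a) (j := i) (a := x)
      (Tuple.monotone_sort a)
  constructor
  -- The bound for `j = 0` is void; the bound for `j + 1` concerns the sorted entry at the
  -- zero-based position `j`.
  · rintro H (_ | j) hj
    · exact Nat.zero_le _
    · have := (key ⟨j, hj⟩ (j + 1)).2 (H ⟨j, hj⟩)
      rw [hcard] at this
      exact this
  · intro H i
    refine (key i _).1 ?_
    rw [hcard]
    exact H (i + 1) i.2

/-- A sequence `s` that drops by `1` over each period `N` has exactly one position, modulo `N`,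
after which it stays at or above its value for the rest of the period. -/
theorem existsUnique_start {N : ℕ} (hN : 0 < N) (s : ℕ → ℤ) (hs : ∀ j, s (j + N) = s j - 1) :
    ∃! r : Fin N, ∀ j < N, s r ≤ s (r + j) := by
  have hex : ∃ r, r < N ∧ ∀ i < N, s r ≤ s i := by
    obtain ⟨r, hr, hmin⟩ := Finset.exists_min_image (Finset.range N) s ⟨0, by simpa using hN⟩
    exact ⟨r, Finset.mem_range.1 hr, fun i hi => hmin i (Finset.mem_range.2 hi)⟩
  classical
  obtain ⟨hr, hmin⟩ := Nat.find_spec hex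
  -- The start is the first minimum in a period. Earlier values are strictly larger integers, so
  -- after dropping by `1` in the next period they are still not below it.
  have hfirst : ∀ i < Nat.find hex, s (Nat.find hex) < s i := by
    intro i hi
    by_contra! hle
    exact Nat.find_min hex hi ⟨hi.trans hr, fun k hk => hle.trans (hmin k hk)⟩
  generalize Nat.find hex = r at hr hmin hfirst
  refine ⟨⟨r, hr⟩, fun j hj => ?_, ?_⟩
  · rcases lt_or_ge (r + j) N with h | h
    · exact hmin _ h
    · have h1 := hfirst (r + j - N) (by omega)
      have h2 := hs (r + j - N)
      rw [Nat.sub_add_cancel h] at h2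
      dsimp only
      omega
  -- Two starts `a < b` contradict each other: `s a ≤ s b`, seen from `a`, and `s b ≤ s (a + N) = s
  -- a - 1`, seen from `b`.
  · have aux (a b : ℕ) (hab : a < b) (hb : b < N) (ha' : ∀ j < N, s a ≤ s (a + j))
        (hb' : ∀ j < N, s b ≤ s (b + j)) : False := by
      have h1 := ha' (b - a) (by omega)
      have h2 := hb' (a + N - b) (by omega)
      rw [show a + (b - a) = b by omega] at h1
      rw [show b + (a + N - b) = a + N by omega, hs] at h2
      omega
    have h0 : ∀ j < N, s r ≤ s (r + j) := by
      intro j hj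
      rcases lt_or_ge (r + j) N with h | h
      · exact hmin _ h
      · have h1 := hfirst (r + j - N) (by omega)
        have h2 := hs (r + j - N)
        rw [Nat.sub_add_cancel h] at h2
        omega
    intro r' hr'
    apply Fin.ext
    rcases lt_trichotomy (r' : ℕ) r with h | h | h
    · exact (aux _ _ h hr hr' h0).elim
    · exact h
    · exact (aux _ _ h r'.2 h0 hr').elim

/-- The number of cars preferring the spot `k` on a circle with `n + 1` spots. -/
def demand {n : ℕ} (f : Fin n → ZMod (n + 1)) (k : ℕ) : ℕ :=
  (Finset.univ.filter fun i => f i = k).card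

theorem sum_demand {n : ℕ} (f : Fin n → ZMod (n + 1)) {j : ℕ} (hj : j ≤ n + 1) :
    ∑ k ∈ Finset.range j, demand f k = (Finset.univ.filter fun i => (f i).val < j).card := by
  rw [Finset.card_eq_sum_card_fiberwise (f := fun i => (f i).val) (t := Finset.range j)
    (fun i hi => by simpa using hi)]
  refine Finset.sum_congr rfl fun k hk => ?_
  rw [Finset.mem_range] at hk
  rw [demand, Finset.filter_filter]
  congr 1
  ext i
  simp only [Finset.mem_filter, Finset.mem_univ, true_and]
  constructor
  · intro h
    rw [h, ZMod.val_natCast_of_lt (by omega)]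
    exact ⟨hk, rfl⟩
  · rintro ⟨-, h⟩
    rw [← h, ZMod.natCast_zmod_val]

/-- The preferences on the circle which leave the last spot free. -/
def IsCircular {n : ℕ} (f : Fin n → ZMod (n + 1)) : Prop :=
  ∀ j ≤ n, j ≤ ∑ k ∈ Finset.range j, demand f k

/-- Spots on the circle are numbered from `0` and entries of parking functions from `1`, whence the
shift; `val + 1 ≤ j` is `val < j`. -/
theorem isCircular_iff {n : ℕ} (f : Fin n → ZMod (n + 1)) :
    IsCircular f ↔ IsParking fun i => (f i).val + 1 := by
  rw [isParking_iff, and_iff_right (fun i => Nat.le_add_left 1 _)]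
  refine forall₂_congr fun j hj => ?_
  rw [sum_demand f (by omega)]
  rfl

/-- Let `s j` be the number of cars preferring the first `j` spots, continued periodically, minus
`j`. With `n` cars on `n + 1` spots, `s` drops by `1` per turn, so the cycle lemma applies; staying
at or above `s r` for one turn is the circular condition for `f - r`. -/
theorem existsUnique_rotation {n : ℕ} (f : Fin n → ZMod (n + 1)) :
    ∃! r : ZMod (n + 1), IsCircular fun i => f i - r := by
  let s : ℕ → ℤ := fun j => ∑ k ∈ Finset.range j, (demand f k : ℤ) - j
  have hper (k : ℕ) : demand f (n + 1 + k) = demand f k := by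
    have : ((n + 1 + k : ℕ) : ZMod (n + 1)) = k := by
      rw [Nat.cast_add, ZMod.natCast_self, zero_add]
    rw [demand, this, demand]
  have htot : ∑ k ∈ Finset.range (n + 1), (demand f k : ℤ) = n := by
    have := sum_demand f le_rfl
    rw [Finset.filter_true_of_mem (fun i _ => ZMod.val_lt (f i)), Finset.card_univ,
      Fintype.card_fin] at this
    exact_mod_cast this
  have hs (j : ℕ) : s (j + (n + 1)) = s j - 1 := by
    simp only [s]
    rw [add_comm j, Finset.sum_range_add, htot]
    simp only [hper]
    push_cast
    ring
  have hrot (r : Fin (n + 1)) :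
      (∀ j < n + 1, s r ≤ s (r + j)) ↔ IsCircular fun i => f i - ((r : ℕ) : ZMod (n + 1)) := by
    refine forall_congr' fun j => imp_congr Nat.lt_succ_iff ?_
    have h1 (k : ℕ) : demand (fun i => f i - ((r : ℕ) : ZMod (n + 1))) k = demand f (r + k) := by
      rw [demand, demand]
      congr 1
      ext i
      simp only [Finset.mem_filter, Finset.mem_univ, true_and, Nat.cast_add]
      rw [sub_eq_iff_eq_add, add_comm (k : ZMod (n + 1))]
    simp only [h1, s]
    rw [Finset.sum_range_add, ← Nat.cast_le (α := ℤ)]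
    push_cast
    constructor <;> intro h <;> linarith
  obtain ⟨r, hr, huniq⟩ := existsUnique_start n.succ_pos s hs
  refine ⟨((r : ℕ) : ZMod (n + 1)), (hrot r).1 hr, fun t ht => ?_⟩
  have h2 := huniq ⟨t.val, ZMod.val_lt t⟩ ((hrot _).2 (by simpa using ht))
  rw [← h2, ZMod.natCast_zmod_val]

/-- Every sequence of preferences on the circle is in exactly one way a rotation of one that
leaves the last spot free. -/
noncomputable def rotationEquiv (n : ℕ) :
    {f : Fin n → ZMod (n + 1) // IsCircular f} × ZMod (n + 1) ≃ (Fin n → ZMod (n + 1)) :=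
  Equiv.ofBijective (fun q i => q.1.1 i + q.2) (by
    constructor
    · rintro ⟨⟨f, hf⟩, r⟩ ⟨⟨g, hg⟩, t⟩ h
      dsimp only at h
      -- Both `r` and `t` are the rotation belonging to the common image `f + r = g + t`.
      have hrt : r = t := by
        refine (existsUnique_rotation fun i => f i + r).unique (by simpa using hf) ?_
        simpa [fun i => congrFun h i] using hg
      subst hrt
      have hfg : f = g := funext fun i => add_right_cancel (congrFun h i)
      subst hfg
      rfl
    · intro f
      obtain ⟨r, hr, -⟩ := existsUnique_rotation f
      exact ⟨⟨⟨_, hr⟩, r⟩, funext fun i => sub_add_cancel _ _⟩)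

/-- Entries of a parking function lie between `1` and `n`, so lowering them by `1` and reducing
modulo `n + 1` loses nothing. -/
noncomputable def circularEquiv (n : ℕ) :
    {f : Fin n → ZMod (n + 1) // IsCircular f} ≃ ParkingFunction n :=
  Equiv.ofBijective (fun f => ⟨_, (isCircular_iff f.1).1 f.2⟩) (by
    constructor
    · intro f g h
      refine Subtype.ext (funext fun i => ZMod.val_injective (n + 1) ?_)
      exact Nat.succ_injective (congrFun (congrArg Subtype.val h) i)
    · rintro ⟨a, ha⟩
      obtain ⟨h1, h2⟩ := (isParking_iff a).1 ha
      -- The counting condition for `j = n` says that all `n` entries are at most `n`.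
      have hle (i : Fin n) : a i ≤ n := by
        have h3 := Finset.card_filter_eq_iff.1
          (le_antisymm ((Finset.card_filter_le _ _).trans (by simp))
            ((Finset.card_fin n).le.trans (h2 n le_rfl)))
        exact h3 i (Finset.mem_univ i)
      have hval (i : Fin n) : (((a i - 1 : ℕ) : ZMod (n + 1))).val + 1 = a i := by
        have h3 := hle i
        have h4 := h1 i
        rw [ZMod.val_natCast_of_lt (by omega)]
        omega
      refine ⟨⟨fun i => ((a i - 1 : ℕ) : ZMod (n + 1)), (isCircular_iff _).2 ?_⟩, ?_⟩
      · simpa only [hval] using ha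
      · exact Subtype.ext (funext hval))

theorem card_parkingFunction_mul (n : ℕ) :
    Nat.card (ParkingFunction n) * (n + 1) = (n + 1) ^ n := by
  have h1 := Nat.card_congr (rotationEquiv n)
  rw [Nat.card_prod, Nat.card_congr (circularEquiv n), Nat.card_fun, Nat.card_zmod,
    Nat.card_fin] at h1
  exact h1

instance finite_parkingFunction (n : ℕ) : Finite (ParkingFunction n) :=
  Finite.of_equiv _ (circularEquiv n)

/-- The exponent is an integer, so that `n = 0` gives `1 ^ (-1) = 1`, the count of the empty parking
function. -/
theorem card_parkingFunction (n : ℕ) :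
    (Nat.card (ParkingFunction n) : ℚ) = ((n : ℚ) + 1) ^ ((n : ℤ) - 1) := by
  have h0 : (n : ℚ) + 1 ≠ 0 := by positivity
  rw [zpow_sub_one₀ h0, zpow_natCast, eq_mul_inv_iff_mul_eq₀ h0]
  exact_mod_cast card_parkingFunction_mul n

/-- The character at the identity is the dimension, and the parking functions form a basis of the
permutation representation. -/
theorem character_parkingFunction_one (n : ℕ) :
    (Representation.ofMulAction ℚ (Equiv.Perm (Fin n)) (ParkingFunction n)).character 1 =
      ((n : ℚ) + 1) ^ ((n : ℤ) - 1) := by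
  have := Fintype.ofFinite (ParkingFunction n)
  rw [Representation.char_one, (MonoidAlgebra.coeffLinearEquiv ℚ).finrank_eq,
    Module.finrank_finsupp_self, ← Nat.card_eq_fintype_card,
    card_parkingFunction]

end SymmFn

theorem corollary2 (n : ℕ) :
    SymmFn.hall (SymmFn.sh n) (SymmFn.p 1 ^ n) = 2 ^ n * ((n : ℚ) + 1) ^ ((n : ℤ) - 1) := by
  rw [SymmFn.hall_p_one_pow, SymmFn.sh,
    SymmFn.coeff_shiftification_of_sqfree _ (SymmFn.sqfree_fullExp n), SymmFn.pf,
    SymmFn.coeff_frobenius_of_sqfree _ (SymmFn.sqfree_fullExp n) (SymmFn.degree_fullExp n),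
    SymmFn.character_parkingFunction_one, SymmFn.degree_fullExp]
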